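/- Theorem 3.5. Work in the language of linear orderings (one binary relation). An infinitary $\Sigma_1$ formula $\varphi(\bar x)$ is a countable disjunction $\bigvee_{i} \exists \bar y_i\, \psi_i(\bar x,\bar y_i)$ with each $\psi_i$ finitary and quantifier-free and each $\bar y_i$ a finite tuple. A substructure $\mathcal B$ of $\mathcal A$ is a $\Sigma_1$ elementary substructure if for all such $\varphi$ and all tuples $\bar b$ from $\mathcal B$, $\mathcal B\models\varphi(\bar b)\iff\mathcal A\models\varphi(\bar b)$. A set $D\subseteq\omega$ is dense if $\lim_{n\to\infty}\frac{|D\cap\{0,\dots,n\}|}{n+1}=1$. A structure whose universe is a subset $B$ of $\omega$ is c.e. if $B$ is a computably enumerable set and each relation is computably enumerable on $B$. A structure $\mathcal A$ with universe $\omega$ is - $\Sigma_1$-generically c.e. if there is a dense c.e. set $D$ such that the substructure $\mathcal D$ of $\mathcal A$ with universe $D$ is c.e. and is a $\Sigma_1$ elementary substructure of $\mathcal A$; - $\Sigma_1$-coarsely c.e. if there are a dense set $D$ and a c.e. structure $\mathcal E$ with universe $\omega$ such that $\mathcal A$ and $\mathcal E$ induce the same substructure $\mathcal D$ on $D$, and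 $\mathcal D$ is a $\Sigma_1$ elementary substructure of both $\mathcal A$ and $\mathcal E$. Then: 1. Every countably infinite linear ordering is isomorphic to a linear ordering with universe $\omega$ that is $\Sigma_1$-generically c.e., and is isomorphic to a linear ordering with universe $\omega$ that is $\Sigma_1$-coarsely c.e. 2. Every infinite linear ordering has an infinite $\Sigma_1$ elementary substructure isomorphic to one of $\zeta$, $\omega$, $\omega^*$, $\omega\cdot\omega^*$, $\omega^*\cdot\omega$, $\eta$. Here $\omega,\zeta,\eta$ are the order types of $\mathbb N,\mathbb Z,\mathbb Q$; $L^*$ is the reverse of $L$; and products are lexicographic with the second coordinate most significant, so that $\omega\cdot\omega^*$ is a descending sequence of copies of $\omega$ and $\omega^*\cdot\omega$ is an ascending sequence of copies of $\omega^*$. -/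

import Mathlib

open FirstOrder Filter Topology

noncomputable section

/-- Formulas of the infinitary logic `L_{ω₁,ω}` with free variables among `x₀, …, x_{n-1}`, in the
normal form used for the quantifier hierarchy: finitary quantifier-free formulas, countable
disjunctions `⋁ᵢ ∃ ȳᵢ φᵢ(x̄, ȳᵢ)` and countable conjunctions `⋀ᵢ ∀ ȳᵢ φᵢ(x̄, ȳᵢ)`, where each `ȳᵢ` is a
finite tuple of length `k i`. -/
inductive InfFormula (L : FirstOrder.Language.{0, 0}) : ℕ → Type
  | qf {n : ℕ} (φ : L.Formula (Fin n)) (h : FirstOrder.Language.BoundedFormula.IsQF φ) : InfFormula L n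
  | disjEx {n : ℕ} (k : ℕ → ℕ) (φ : (i : ℕ) → InfFormula L (n + k i)) : InfFormula L n
  | conjAll {n : ℕ} (k : ℕ → ℕ) (φ : (i : ℕ) → InfFormula L (n + k i)) : InfFormula L n

namespace InfFormula

variable {L : FirstOrder.Language.{0, 0}}

/-- Satisfaction of an infinitary formula by a tuple of a structure. -/
def Realize {M : Type*} [L.Structure M] : {n : ℕ} → InfFormula L n → (Fin n → M) → Prop
  | _, .qf φ _, v => FirstOrder.Language.Formula.Realize φ v
  | _, .disjEx k φ, v => ∃ i, ∃ y : Fin (k i) → M, (φ i).Realize (Fin.append v y)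
  | _, .conjAll k φ, v => ∀ i, ∀ y : Fin (k i) → M, (φ i).Realize (Fin.append v y)

mutual

/-- `φ.IsSigma α`: `φ` is a `Σ_α` formula. Finitary quantifier-free formulas are `Σ₀ = Π₀`, and
`⋁ᵢ ∃ ȳᵢ φᵢ` is `Σ_α` when each `φᵢ` is `Π_β` for some `β < α`. -/
def IsSigma : {n : ℕ} → InfFormula L n → Ordinal.{0} → Prop
  | _, .qf _ _, _ => True
  | _, .disjEx _ φ, α => ∀ i, ∃ β < α, (φ i).IsPi β
  | _, .conjAll _ _, _ => False

/-- `φ.IsPi α`: `φ` is a `Π_α` formula; `⋀ᵢ ∀ ȳᵢ φᵢ` is `Π_α` when each `φᵢ` is `Σ_β` for some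
`β < α`. -/
def IsPi : {n : ℕ} → InfFormula L n → Ordinal.{0} → Prop
  | _, .qf _ _, _ => True
  | _, .disjEx _ _, _ => False
  | _, .conjAll _ φ, α => ∀ i, ∃ β < α, (φ i).IsSigma β

end

end InfFormula

/-- The embedding `j` of `L`-structures preserves and reflects all infinitary `Σ_α` formulas. When
`j` is the inclusion of a substructure, this says that it is a `Σ_α` elementary substructure. -/
def IsSigmaElementary {L : FirstOrder.Language.{0, 0}} (α : Ordinal.{0}) {M N : Type*} [L.Structure M]
    [L.Structure N] (j : M ↪[L] N) : Prop :=
  ∀ (n : ℕ) (φ : InfFormula L n), φ.IsSigma α →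
    ∀ v : Fin n → M, φ.Realize v ↔ φ.Realize (fun i => j (v i))

open Classical in
/-- `S ⊆ ℕ` has asymptotic density one: `|S ∩ {0, …, n}| / (n + 1) → 1`. -/
def HasDensityOne (S : Set ℕ) : Prop :=
  Tendsto (fun n : ℕ => (((Finset.range (n + 1)).filter (· ∈ S)).card : ℝ) / ((n : ℝ) + 1))
    atTop (𝓝 1)

/-- The substructure `B` of a structure with universe `ℕ` is a c.e. structure: its universe, each of
its relations and the graph of each of its functions are computably enumerable. -/
def IsCESubstructure {L : FirstOrder.Language.{0, 0}} [L.Structure ℕ] (B : L.Substructure ℕ) : Prop :=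
  REPred (fun x : ℕ => x ∈ B) ∧
  (∀ (k : ℕ) (R : L.Relations k),
    REPred fun v : Fin k → ℕ => (∀ i, v i ∈ B) ∧ FirstOrder.Language.Structure.RelMap R v) ∧
  (∀ (k : ℕ) (f : L.Functions k),
    REPred fun p : (Fin k → ℕ) × ℕ => (∀ i, p.1 i ∈ B) ∧ FirstOrder.Language.Structure.funMap f p.1 = p.2)

/-- A structure with universe `ℕ` is c.e. when it is so as a substructure of itself. -/
def IsCEStructure (L : FirstOrder.Language.{0, 0}) [L.Structure ℕ] : Prop :=
  IsCESubstructure (⊤ : L.Substructure ℕ)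

/-- The `L`-structure on `ℕ` at hand is `Σ_α`-generically c.e. -/
def IsSigmaGenericallyCE (L : FirstOrder.Language.{0, 0}) (α : Ordinal.{0}) [L.Structure ℕ] : Prop :=
  ∃ D : L.Substructure ℕ,
    HasDensityOne (D : Set ℕ) ∧ IsCESubstructure D ∧ IsSigmaElementary α D.subtype

/-- The `L`-structure on `ℕ` at hand, say `A`, is `Σ_α`-coarsely c.e.: there are a dense set `D` and
a c.e. structure `E` with universe `ℕ` such that `D`, as a substructure of `A`, is also a
substructure of `E`, `Σ_α` elementary in both. The embedding `j` is the inclusion of `D` in `E`. -/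
def IsSigmaCoarselyCE (L : FirstOrder.Language.{0, 0}) (α : Ordinal.{0}) [L.Structure ℕ] : Prop :=
  ∃ D : L.Substructure ℕ,
    HasDensityOne (D : Set ℕ) ∧ IsSigmaElementary α D.subtype ∧
    ∃ E : L.Structure ℕ, @IsCEStructure L E ∧
      ∃ j : @FirstOrder.Language.Embedding L D ℕ _ E,
        (∀ x : D, j.toEmbedding x = (x : ℕ)) ∧
        @IsSigmaElementary L α D ℕ _ E j

/-- Some copy of `M` with universe `ℕ` is `Σ_α`-generically c.e. -/
def HasSigmaGenericallyCECopy (L : FirstOrder.Language.{0, 0}) (α : Ordinal.{0}) (M : Type*)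
    [L.Structure M] : Prop :=
  ∃ A : L.Structure ℕ, Nonempty (@FirstOrder.Language.Equiv L M ℕ _ A) ∧ @IsSigmaGenericallyCE L α A

/-- Some copy of `M` with universe `ℕ` is `Σ_α`-coarsely c.e. -/
def HasSigmaCoarselyCECopy (L : FirstOrder.Language.{0, 0}) (α : Ordinal.{0}) (M : Type*)
    [L.Structure M] : Prop :=
  ∃ A : L.Structure ℕ, Nonempty (@FirstOrder.Language.Equiv L M ℕ _ A) ∧ @IsSigmaCoarselyCE L α A

/-- A linear order is one of `ζ`, `ω`, `ω*`, `ω·ω*`, `ω*·ω`, `η`. In a product the second factor is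
the most significant one, so `ω·ω*` is a descending sequence of copies of `ω` and `ω*·ω` an
ascending sequence of copies of `ω*`; in Mathlib's `×ₗ` the first factor is the most significant. -/
def IsBasicOrder (X : Type*) [LinearOrder X] : Prop :=
  Nonempty (X ≃o ℤ) ∨ Nonempty (X ≃o ℕ) ∨ Nonempty (X ≃o ℕᵒᵈ) ∨
    Nonempty (X ≃o ℕᵒᵈ ×ₗ ℕ) ∨ Nonempty (X ≃o ℕ ×ₗ ℕᵒᵈ) ∨ Nonempty (X ≃o ℚ)

end

/-!
A `Σ₁` formula over a tuple `v` of a linear order asserts that the tuple extends to one of countably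
many finite configurations. An infinite suborder `S` of `X` is therefore `Σ₁` elementary as soon as
the inclusion preserves gaps (`PreservesGaps`): neighbours in `S` are neighbours in `X`, and end
points of `S` are end points of `X`. A point of `X` outside `S` then has points of `S` accumulating
at its cut from below or from above, so a finite tuple of `X` can be moved into `S`, one value at a
time, without changing its order type and without moving its entries from `S`
(`PreservesGaps.exists_pullback`, `PreservesGaps.isSigmaElementary`).

Every infinite linear order has a gap-preserving suborder of basic type (`hasBasicSuborder`).
Consider the points whose iterated immediate successors never stop, and those whose iterated
immediate predecessors never stop. A point of both kinds lies on a convex copy of `ζ`. Otherwise the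
successor chains of type `ω` have beginnings; if these have no least one, they provide `ω·ω*`, and if
the least one is the least point of `X`, it provides `ω`. The predecessor chains of type `ω*` are
treated dually. If none of these types arises, there is a convex set with at least two chains, all of
them finite. No two finite maximal chains are adjacent, so their last points form a dense order, which
contains `η`; and a copy of `η` preserves gaps because it has neither neighbours nor end points.

For the copies on `ℕ`, each basic order has a primitive recursive copy on `ℕ`
(`IsBasicOrder.hasPrimrecCopy`), which is carried over to a primitive recursive set `D` of density
one whose complement has as many points as the complement of `S` in `X` (`exists_dense_set`). Placing
the rest of `X` on the complement of `D` gives the generically c.e. copy. It is also coarsely c.e.: a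
basic order lacks a greatest or a least element, so the order on `D` still preserves gaps when the
complement of `D`, with its natural order, is put above or below it
(`exists_primrec_extension`).
-/

/-! ### Finite tuples along embeddings that preserve covers and end points -/

/-- A map of orders that sends covering pairs to covering pairs, minimal elements to minimal
elements and maximal elements to maximal elements. For an embedding of an infinite linear order into
another one this says exactly that gaps of the image contain no new points unless they contain
infinitely many points of the image. -/
structure PreservesGaps {α β : Type*} [LinearOrder α] [LinearOrder β] (f : α → β) : Prop where
  covBy : ∀ {a b}, a ⋖ b → f a ⋖ f b
  isMin : ∀ {a}, IsMin a → IsMin (f a)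
  isMax : ∀ {a}, IsMax a → IsMax (f a)

/-- The part of the set `R` strictly below `y` is nonempty and has no greatest element. -/
def ApproachedFromBelow {β : Type*} [LinearOrder β] (R : Set β) (y : β) : Prop :=
  (∃ r ∈ R, r < y) ∧ ∀ r ∈ R, r < y → ∃ s ∈ R, r < s ∧ s < y

/-- The part of the set `R` strictly above `y` is nonempty and has no least element. -/
def ApproachedFromAbove {β : Type*} [LinearOrder β] (R : Set β) (y : β) : Prop :=
  (∃ r ∈ R, y < r) ∧ ∀ r ∈ R, y < r → ∃ s ∈ R, s < r ∧ y < s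

/-- If neither alternative held, the points of `α` on the two sides of `y` would meet in a covering
pair or one side would be all of `α`, with an end point next to `y`. -/
theorem PreservesGaps.approached {α β : Type*} [LinearOrder α] [LinearOrder β] [Nonempty α]
    {f : α ↪o β} (hf : PreservesGaps f) {y : β} (hy : y ∉ Set.range f) :
    ApproachedFromBelow (Set.range f) y ∨ ApproachedFromAbove (Set.range f) y := by
  have hne : ∀ a, f a ≠ y := fun a h => hy ⟨a, h⟩
  by_contra hcon
  rw [not_or] at hcon
  obtain ⟨hB, hA⟩ := hcon
  have hB' : (∀ a, y < f a) ∨ ∃ a, f a < y ∧ ∀ b, f b < y → b ≤ a := by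
    by_cases h : ∃ a, f a < y
    · right
      by_contra hc
      push Not at hc
      obtain ⟨a, ha⟩ := h
      refine hB ⟨⟨_, ⟨a, rfl⟩, ha⟩, ?_⟩
      rintro _ ⟨c, rfl⟩ hcy
      obtain ⟨b, hb, hcb⟩ := hc c hcy
      exact ⟨_, ⟨b, rfl⟩, f.lt_iff_lt.2 hcb, hb⟩
    · left
      push Not at h
      exact fun a => lt_of_le_of_ne (h a) (hne a).symm
  have hA' : (∀ a, f a < y) ∨ ∃ a, y < f a ∧ ∀ b, y < f b → a ≤ b := by
    by_cases h : ∃ a, y < f a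
    · right
      by_contra hc
      push Not at hc
      obtain ⟨a, ha⟩ := h
      refine hA ⟨⟨_, ⟨a, rfl⟩, ha⟩, ?_⟩
      rintro _ ⟨c, rfl⟩ hcy
      obtain ⟨b, hb, hcb⟩ := hc c hcy
      exact ⟨_, ⟨b, rfl⟩, f.lt_iff_lt.2 hcb, hb⟩
    · left
      push Not at h
      exact fun a => lt_of_le_of_ne (h a) (hne a)
  obtain ⟨x⟩ := ‹Nonempty α›
  rcases hB' with hB' | ⟨a, hay, ha⟩ <;> rcases hA' with hA' | ⟨b, hyb, hb⟩
  · exact lt_asymm (hA' x) (hB' x)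
  · have hmin : IsMin b := fun c _ => hb c (hB' c)
    exact hyb.not_ge (hf.isMin hmin hyb.le)
  · have hmax : IsMax a := fun c _ => ha c (hA' c)
    exact hay.not_ge (hf.isMax hmax hay.le)
  · have hab : a ⋖ b := by
      refine ⟨f.lt_iff_lt.1 (hay.trans hyb), fun c hac hcb => ?_⟩
      rcases lt_or_gt_of_ne (hne c) with h | h
      · exact hac.not_ge (ha c h)
      · exact hcb.not_ge (hb c h)
    exact (hf.covBy hab).2 hay hyb

/-- The entries of a finite tuple that equal `y`, the least entry outside `R` that is approached
from below by `R`, can be moved down into `R` without changing the order type of the tuple. -/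
theorem exists_move_below {β ι : Type*} [LinearOrder β] [Finite ι] {R : Set β} (w : ι → β) {y : β}
    (hyw : y ∈ Set.range w \ R) (hy : ApproachedFromBelow R y)
    (hmin : ∀ z ∈ Set.range w \ R, ApproachedFromBelow R z → y ≤ z) :
    ∃ w₂ : ι → β, (∀ i j, w₂ i ≤ w₂ j ↔ w i ≤ w j) ∧ (∀ i, w i ∈ R → w₂ i = w i) ∧
      Set.range w₂ \ R ⊂ Set.range w \ R := by
  classical
  have key : ∀ i, ∃ r ∈ R, r < y ∧ (w i < y → w i < r) := by
    intro i
    by_cases hi : w i < y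
    · suffices ∃ r ∈ R, r < y ∧ w i < r by
        obtain ⟨r, h1, h2, h3⟩ := this
        exact ⟨r, h1, h2, fun _ => h3⟩
      by_cases hiR : w i ∈ R
      · obtain ⟨s, hs, h1, h2⟩ := hy.2 _ hiR hi
        exact ⟨s, hs, h2, h1⟩
      · by_contra hc
        push Not at hc
        -- no point of `R` separates `w i` from `y`, so `w i` is approached from below as well
        have hc' : ∀ r ∈ R, r < y → r < w i := fun r hr hry =>
          lt_of_le_of_ne (hc r hr hry) (fun h => hiR (h ▸ hr))
        refine hi.not_ge (hmin (w i) ⟨⟨i, rfl⟩, hiR⟩ ⟨?_, ?_⟩)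
        · obtain ⟨r, hr, hry⟩ := hy.1
          exact ⟨r, hr, hc' r hr hry⟩
        · intro r hr hrw
          obtain ⟨s, hs, h1, h2⟩ := hy.2 r hr (hrw.trans hi)
          exact ⟨s, hs, h1, hc' s hs h2⟩
    · obtain ⟨r, hr, hry⟩ := hy.1
      exact ⟨r, hr, hry, fun h => absurd h hi⟩
  choose r hrR hry hwr using key
  obtain ⟨⟨i₀, hi₀⟩, hyR⟩ := hyw
  have : Nonempty ι := ⟨i₀⟩
  obtain ⟨m, hm⟩ := Finite.exists_max r
  have hlow : ∀ i, w i < y → w i < r m := fun i hi => (hwr i hi).trans_le (hm i)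
  refine ⟨fun i => if w i = y then r m else w i, ?_, ?_, ?_⟩
  · intro i j
    dsimp only
    have h1 := hlow i
    have h2 := hlow j
    have h3 := hry m
    split_ifs with hi hj hj
    · simp [hi, hj]
    · rw [hi]
      constructor
      · intro h
        by_contra hc
        exact (h2 (not_le.1 hc)).not_ge h
      · exact fun h => h3.le.trans h
    · rw [hj]
      constructor
      · exact fun h => h.trans h3.le
      · exact fun h => (h1 (lt_of_le_of_ne h hi)).le
    · rfl
  · intro i hi
    have : w i ≠ y := fun h => hyR (h ▸ hi)
    simp [this]
  · rw [Set.ssubset_iff_of_subset]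
    · refine ⟨y, ⟨⟨i₀, hi₀⟩, hyR⟩, ?_⟩
      rintro ⟨⟨i, hi⟩, -⟩
      dsimp only at hi
      split_ifs at hi with h
      · exact (hry m).ne hi
      · exact h hi
    · rintro _ ⟨⟨i, rfl⟩, hi⟩
      dsimp only at hi ⊢
      split_ifs at hi ⊢ with h
      · exact absurd (hrR m) hi
      · exact ⟨⟨i, rfl⟩, hi⟩

theorem exists_move_above {β ι : Type*} [LinearOrder β] [Finite ι] {R : Set β} (w : ι → β) {y : β}
    (hyw : y ∈ Set.range w \ R) (hy : ApproachedFromAbove R y)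
    (hmax : ∀ z ∈ Set.range w \ R, ApproachedFromAbove R z → z ≤ y) :
    ∃ w₂ : ι → β, (∀ i j, w₂ i ≤ w₂ j ↔ w i ≤ w j) ∧ (∀ i, w i ∈ R → w₂ i = w i) ∧
      Set.range w₂ \ R ⊂ Set.range w \ R := by
  obtain ⟨w₂, h1, h2, h3⟩ := exists_move_below (β := βᵒᵈ) (R := R) w hyw hy hmax
  exact ⟨w₂, fun i j => h1 j i, h2, h3⟩

/-- A finite tuple of the target can be pulled back to a tuple of the source with the same order
type, without moving the entries that come from the source. -/
theorem PreservesGaps.exists_pullback {α β ι : Type*} [LinearOrder α] [LinearOrder β] [Nonempty α]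
    [Finite ι] {f : α ↪o β} (hf : PreservesGaps f) (w : ι → β) :
    ∃ w' : ι → α, (∀ i j, w' i ≤ w' j ↔ w i ≤ w j) ∧ ∀ i a, w i = f a → w' i = a := by
  induction hn : (Set.range w \ Set.range f).ncard using Nat.strong_induction_on generalizing w with
  | _ n ih =>
  have hfin : (Set.range w \ Set.range f).Finite := (Set.finite_range w).sdiff
  by_cases hemp : (Set.range w \ Set.range f) = ∅
  · have : ∀ i, ∃ a, f a = w i := fun i => by
      by_contra h
      exact (hemp ▸ (⟨⟨i, rfl⟩, h⟩ : w i ∈ Set.range w \ Set.range f) : w i ∈ (∅ : Set β))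
    choose a ha using this
    refine ⟨a, fun i j => ?_, fun i b hb => ?_⟩
    · rw [← ha i, ← ha j, f.le_iff_le]
    · rw [← ha i] at hb
      exact f.injective hb
  · suffices ∃ w₂ : ι → β, (∀ i j, w₂ i ≤ w₂ j ↔ w i ≤ w j) ∧
        (∀ i, w i ∈ Set.range f → w₂ i = w i) ∧
        Set.range w₂ \ Set.range f ⊂ Set.range w \ Set.range f by
      obtain ⟨w₂, h1, h2, h3⟩ := this
      obtain ⟨w', h4, h5⟩ := ih _ (hn ▸ Set.ncard_lt_ncard h3 hfin) w₂ rfl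
      refine ⟨w', fun i j => (h4 i j).trans (h1 i j), fun i a h => h5 i a ?_⟩
      rw [h2 i ⟨a, h.symm⟩, h]
    obtain ⟨z, hz⟩ := Set.nonempty_iff_ne_empty.2 hemp
    rcases hf.approached hz.2 with h | h
    · obtain ⟨y, hy, hmin⟩ := Set.exists_min_image
        {z ∈ Set.range w \ Set.range f | ApproachedFromBelow (Set.range f) z} id
        (hfin.subset (Set.sep_subset _ _)) ⟨z, hz, h⟩
      exact exists_move_below w hy.1 hy.2 fun z hz h => hmin z ⟨hz, h⟩
    · obtain ⟨y, hy, hmax⟩ := Set.exists_max_image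
        {z ∈ Set.range w \ Set.range f | ApproachedFromAbove (Set.range f) z} id
        (hfin.subset (Set.sep_subset _ _)) ⟨z, hz, h⟩
      exact exists_move_above w hy.1 hy.2 fun z hz h => hmax z ⟨hz, h⟩

/-! ### Infinitary `Σ₁` formulas in the language of orders -/

section Formulas

open FirstOrder.Language FirstOrder.Language.Structure

theorem InfFormula.IsPi.eq_qf {L : FirstOrder.Language.{0, 0}} {n : ℕ} {φ : InfFormula L n}
    (h : φ.IsPi 0) : ∃ ψ hψ, φ = .qf ψ hψ := by
  cases φ with
  | qf ψ hψ => exact ⟨ψ, hψ, rfl⟩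
  | disjEx k φ => simp [InfFormula.IsPi] at h
  | conjAll k φ =>
    simp only [InfFormula.IsPi] at h
    obtain ⟨β, hβ, -⟩ := h 0
    exact absurd hβ not_lt_zero

theorem realize_qf_congr {M N : Type*} [FirstOrder.Language.order.Structure M]
    [FirstOrder.Language.order.Structure N] {γ : Type*} {l : ℕ}
    {ψ : FirstOrder.Language.order.BoundedFormula γ l} (hψ : ψ.IsQF)
    (v : γ → M) (xs : Fin l → M) (v' : γ → N) (xs' : Fin l → N)
    (heq : ∀ i j, Sum.elim v xs i = Sum.elim v xs j ↔ Sum.elim v' xs' i = Sum.elim v' xs' j)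
    (hle : ∀ i j,
      RelMap (L := FirstOrder.Language.order) leSymb ![Sum.elim v xs i, Sum.elim v xs j] ↔
      RelMap (L := FirstOrder.Language.order) leSymb ![Sum.elim v' xs' i, Sum.elim v' xs' j]) :
    ψ.Realize v xs ↔ ψ.Realize v' xs' := by
  have hvar : ∀ t : FirstOrder.Language.order.Term (γ ⊕ Fin l), ∃ i, t = .var i := by
    rintro (i | ⟨f, ts⟩)
    · exact ⟨i, rfl⟩
    · exact isEmptyElim f
  induction hψ with
  | falsum => rfl
  | of_isAtomic h =>
    cases h with
    | equal t₁ t₂ =>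
      obtain ⟨i, rfl⟩ := hvar t₁
      obtain ⟨j, rfl⟩ := hvar t₂
      exact heq i j
    | rel R ts =>
      cases R
      obtain ⟨i, hi⟩ := hvar (ts 0)
      obtain ⟨j, hj⟩ := hvar (ts 1)
      have h1 : (fun k => (ts k).realize (Sum.elim v xs)) =
          ![Sum.elim v xs i, Sum.elim v xs j] := by
        funext k; fin_cases k <;> simp [hi, hj]
      have h2 : (fun k => (ts k).realize (Sum.elim v' xs')) =
          ![Sum.elim v' xs' i, Sum.elim v' xs' j] := by
        funext k; fin_cases k <;> simp [hi, hj]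
      change RelMap (L := FirstOrder.Language.order) leSymb
          (fun k => (ts k).realize (Sum.elim v xs)) ↔
        RelMap (L := FirstOrder.Language.order) leSymb
          (fun k => (ts k).realize (Sum.elim v' xs'))
      rw [h1, h2]
      exact hle i j
  | imp _ _ ih₁ ih₂ => exact imp_congr ih₁ ih₂

/-- An embedding of structures that becomes a gap-preserving embedding of linear orders, after its
source is identified with the linear order `α` and its target with a part of the linear order `β`,
is `Σ₁` elementary. -/
theorem PreservesGaps.isSigmaElementary {M N α β : Type*} [FirstOrder.Language.order.Structure M]
    [FirstOrder.Language.order.Structure N] [LinearOrder α] [LinearOrder β] [Nonempty α]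
    (p : M ≃ α) (q : N → β) (hq : Function.Injective q)
    (hM : ∀ x y : M, RelMap (L := FirstOrder.Language.order) leSymb ![x, y] ↔ p x ≤ p y)
    (hN : ∀ x y : N, RelMap (L := FirstOrder.Language.order) leSymb ![x, y] ↔ q x ≤ q y)
    {f : α ↪o β} (hf : PreservesGaps f) (j : M ↪[FirstOrder.Language.order] N)
    (hj : ∀ x, q (j x) = f (p x)) : IsSigmaElementary 1 j := by
  have hqf : ∀ {n : ℕ} (ψ : FirstOrder.Language.order.Formula (Fin n)),
      BoundedFormula.IsQF ψ → ∀ (v : Fin n → M) (v' : Fin n → N),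
      (∀ a b, p (v a) ≤ p (v b) ↔ q (v' a) ≤ q (v' b)) → (ψ.Realize v ↔ ψ.Realize v') := by
    intro n ψ hψ v v' hv
    refine realize_qf_congr hψ _ _ _ _ ?_ ?_
    · rintro (a | a) (b | b)
      · simp only [Sum.elim_inl]
        rw [← p.injective.eq_iff, ← hq.eq_iff, le_antisymm_iff, le_antisymm_iff, hv, hv]
      all_goals first | exact a.elim0 | exact b.elim0
    · rintro (a | a) (b | b)
      · simp only [Sum.elim_inl]
        rw [hM, hN, hv]
      all_goals first | exact a.elim0 | exact b.elim0
  intro n φ hφ v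
  cases φ with
  | qf ψ hψ =>
    refine hqf ψ hψ _ _ fun a b => ?_
    rw [hj, hj, f.le_iff_le]
  | conjAll k φ => simp [InfFormula.IsSigma] at hφ
  | disjEx k φ =>
    simp only [InfFormula.IsSigma] at hφ
    simp only [InfFormula.Realize]
    refine exists_congr fun i => ?_
    obtain ⟨β', hβ', hi⟩ := hφ i
    obtain rfl : β' = 0 := Order.lt_one_iff.1 hβ'
    obtain ⟨ψ, hψ, hψi⟩ := hi.eq_qf
    rw [hψi]
    simp only [InfFormula.Realize]
    constructor
    · rintro ⟨y, hy⟩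
      refine ⟨fun a => j (y a), (hqf ψ hψ _ _ fun a b => ?_).1 hy⟩
      have h : ∀ a, q (Fin.append (fun i => j (v i)) (fun a => j (y a)) a) =
          f (p (Fin.append v y a)) := by
        intro a
        refine Fin.addCases (fun a => ?_) (fun a => ?_) a <;> simp [hj]
      rw [h, h, f.le_iff_le]
    · rintro ⟨y, hy⟩
      obtain ⟨w', h1, h2⟩ := hf.exists_pullback
        (fun a => q (Fin.append (fun i => j (v i)) y a))
      refine ⟨fun a => p.symm (w' (Fin.natAdd n a)), (hqf ψ hψ _ _ fun a b => ?_).2 hy⟩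
      have h : ∀ a, p (Fin.append v (fun a => p.symm (w' (Fin.natAdd n a))) a) = w' a := by
        intro a
        refine Fin.addCases (fun a => ?_) (fun a => ?_) a
        · simp only [Fin.append_left]
          exact (h2 _ _ (by simp [hj])).symm
        · simp
      rw [h, h, h1]

end Formulas

/-! ### Gap-preserving suborders of basic type -/

/-- The order has an infinite suborder of basic type whose inclusion preserves gaps. -/
def HasBasicSuborder (X : Type*) [LinearOrder X] : Prop :=
  ∃ S : Set X, S.Infinite ∧ PreservesGaps (Subtype.val : S → X) ∧ IsBasicOrder S

theorem IsBasicOrder.of_orderIso {X Y : Type*} [LinearOrder X] [LinearOrder Y] (e : Y ≃o X)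
    (h : IsBasicOrder X) : IsBasicOrder Y := by
  unfold IsBasicOrder at *
  rcases h with ⟨⟨i⟩⟩ | ⟨⟨i⟩⟩ | ⟨⟨i⟩⟩ | ⟨⟨i⟩⟩ | ⟨⟨i⟩⟩ | ⟨⟨i⟩⟩
  · exact Or.inl ⟨e.trans i⟩
  · exact Or.inr <| Or.inl ⟨e.trans i⟩
  · exact Or.inr <| Or.inr <| Or.inl ⟨e.trans i⟩
  · exact Or.inr <| Or.inr <| Or.inr <| Or.inl ⟨e.trans i⟩
  · exact Or.inr <| Or.inr <| Or.inr <| Or.inr <| Or.inl ⟨e.trans i⟩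
  · exact Or.inr <| Or.inr <| Or.inr <| Or.inr <| Or.inr ⟨e.trans i⟩

theorem HasBasicSuborder.of_embedding {B X : Type*} [LinearOrder B] [LinearOrder X] [Infinite B]
    (f : B ↪o X) (hf : PreservesGaps f) (hB : IsBasicOrder B) : HasBasicSuborder X := by
  refine ⟨Set.range f, Set.infinite_range_of_injective f.injective, ?_,
    hB.of_orderIso f.orderIso.symm⟩
  refine ⟨?_, ?_, ?_⟩
  · rintro ⟨_, a, rfl⟩ ⟨_, b, rfl⟩ h
    exact hf.covBy ((apply_covBy_apply_iff f.orderIso).1 h)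
  · rintro ⟨_, a, rfl⟩ h
    exact hf.isMin (f.orderIso.isMin_apply.1 h)
  · rintro ⟨_, a, rfl⟩ h
    exact hf.isMax (f.orderIso.isMax_apply.1 h)

/-- Reversing a lexicographic product of linear orders reverses both factors. -/
def lexProdDual (α β : Type*) [LinearOrder α] [LinearOrder β] : (α ×ₗ β)ᵒᵈ ≃o αᵒᵈ ×ₗ βᵒᵈ where
  toFun x := toLex (OrderDual.toDual (ofLex (OrderDual.ofDual x)).1,
    OrderDual.toDual (ofLex (OrderDual.ofDual x)).2)
  invFun x := OrderDual.toDual (toLex (OrderDual.ofDual (ofLex x).1, OrderDual.ofDual (ofLex x).2))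
  left_inv _ := rfl
  right_inv _ := rfl
  map_rel_iff' := by
    intro x y
    change toLex _ ≤ toLex _ ↔ OrderDual.ofDual y ≤ OrderDual.ofDual x
    rw [Prod.Lex.le_iff, Prod.Lex.le_iff]
    refine or_congr Iff.rfl (and_congr ?_ Iff.rfl)
    exact eq_comm

theorem IsBasicOrder.dual {X : Type*} [LinearOrder X] (h : IsBasicOrder X) : IsBasicOrder Xᵒᵈ := by
  unfold IsBasicOrder at *
  rcases h with ⟨⟨i⟩⟩ | ⟨⟨i⟩⟩ | ⟨⟨i⟩⟩ | ⟨⟨i⟩⟩ | ⟨⟨i⟩⟩ | ⟨⟨i⟩⟩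
  · exact Or.inl ⟨i.dual.trans (OrderIso.neg ℤ).symm⟩
  · exact Or.inr <| Or.inr <| Or.inl ⟨i.dual⟩
  · exact Or.inr <| Or.inl ⟨i.dual.trans (OrderIso.dualDual ℕ).symm⟩
  · exact Or.inr <| Or.inr <| Or.inr <| Or.inr <| Or.inl ⟨i.dual.trans (lexProdDual ℕᵒᵈ ℕ)⟩
  · exact Or.inr <| Or.inr <| Or.inr <| Or.inl ⟨i.dual.trans (lexProdDual ℕ ℕᵒᵈ)⟩
  · exact Or.inr <| Or.inr <| Or.inr <| Or.inr <| Or.inr ⟨i.dual.trans (OrderIso.neg ℚ).symm⟩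

theorem HasBasicSuborder.of_dual {X : Type*} [LinearOrder X] (h : HasBasicSuborder Xᵒᵈ) :
    HasBasicSuborder X := by
  obtain ⟨S, hS, hg, hb⟩ := h
  have : Infinite S := hS.to_subtype
  have : Infinite (↥S)ᵒᵈ := ‹Infinite S›
  refine HasBasicSuborder.of_embedding
    ((OrderEmbedding.subtype (· ∈ S)).dual.trans (OrderIso.dualDual X).symm.toOrderEmbedding)
    ⟨?_, ?_, ?_⟩ hb.dual
  · intro a b h
    exact toDual_covBy_toDual_iff.1 (hg.covBy (toDual_covBy_toDual_iff.1 h))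
  · intro a h
    exact (hg.isMax (a := OrderDual.ofDual a) (fun b hb => h hb))
  · intro a h
    exact (hg.isMin (a := OrderDual.ofDual a) (fun b hb => h hb))

section Chains

open Relation

variable {X : Type*} [LinearOrder X]

/-- Every point reached from `x` by finitely many immediate successors has an immediate successor:
the successors of `x` form a chain of type `ω`. -/
def AscendsForever (x : X) : Prop :=
  ∀ y, ReflTransGen (· ⋖ ·) x y → ∃ z, y ⋖ z

/-- Every point reached from `x` by finitely many immediate predecessors has an immediate
predecessor. -/
def DescendsForever (x : X) : Prop :=
  ∀ y, ReflTransGen (· ⋖ ·) y x → ∃ z, z ⋖ y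

theorem reflTransGen_covBy_toDual {x y : X} :
    ReflTransGen (· ⋖ ·) (OrderDual.toDual x) (OrderDual.toDual y) ↔
      ReflTransGen (· ⋖ ·) y x := by
  rw [← reflTransGen_swap]
  constructor
  · intro h
    exact h.lift OrderDual.ofDual fun a b hab => ofDual_covBy_ofDual_iff.2 hab
  · intro h
    exact h.lift (p := Function.swap (· ⋖ ·)) OrderDual.toDual
      fun a b hab => toDual_covBy_toDual_iff.2 hab

theorem ascendsForever_toDual {x : X} :
    AscendsForever (OrderDual.toDual x) ↔ DescendsForever x := by
  constructor
  · intro h y hy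
    obtain ⟨z, hz⟩ := h (OrderDual.toDual y) (reflTransGen_covBy_toDual.2 hy)
    exact ⟨OrderDual.ofDual z, ofDual_covBy_ofDual_iff.2 hz⟩
  · intro h y hy
    obtain ⟨z, hz⟩ := h (OrderDual.ofDual y) (reflTransGen_covBy_toDual.1 hy)
    exact ⟨OrderDual.toDual z, ofDual_covBy_ofDual_iff.1 hz⟩

theorem le_of_reflTransGen_covBy {x y : X} (h : ReflTransGen (· ⋖ ·) x y) : x ≤ y := by
  induction h with
  | refl => exact le_rfl
  | tail _ h ih => exact ih.trans h.le

theorem lt_of_reflTransGen_covBy {x y s : X} (h : ReflTransGen (· ⋖ ·) x y)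
    (hs : ∀ z, ¬ z ⋖ s) (hx : x < s) : y < s := by
  induction h with
  | refl => exact hx
  | @tail b c _ h ih =>
    rcases lt_or_ge c s with hc | hc
    · exact hc
    · rcases hc.eq_or_lt with rfl | hc
      · exact absurd h (hs b)
      · exact absurd hc (h.2 ih)

theorem lt_of_covBy_reflTransGen {x y s : X} (h : ReflTransGen (· ⋖ ·) x y)
    (hs : ∀ z, ¬ s ⋖ z) (hy : s < y) : s < x :=
  lt_of_reflTransGen_covBy (X := Xᵒᵈ) (reflTransGen_covBy_toDual.2 h)
    (fun _ hz => hs _ (ofDual_covBy_ofDual_iff.2 hz)) hy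

theorem exists_top_of_not_ascendsForever {x : X} (h : ¬ AscendsForever x) :
    ∃ t, ReflTransGen (· ⋖ ·) x t ∧ ∀ z, ¬ t ⋖ z := by
  unfold AscendsForever at h
  push Not at h
  exact h

theorem exists_bot_of_not_descendsForever {x : X} (h : ¬ DescendsForever x) :
    ∃ t, ReflTransGen (· ⋖ ·) t x ∧ ∀ z, ¬ z ⋖ t := by
  unfold DescendsForever at h
  push Not at h
  exact h

theorem AscendsForever.of_reflTransGen {x t : X} (h : AscendsForever x)
    (ht : ReflTransGen (· ⋖ ·) t x) : AscendsForever t := by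
  intro y hy
  rcases ReflTransGen.total_of_right_unique (fun _ _ _ h₁ h₂ => h₁.unique_right h₂) ht hy
    with hxy | hyx
  · exact h y hxy
  · rcases hyx.cases_head with rfl | ⟨z, hz, -⟩
    · exact h _ .refl
    · exact ⟨z, hz⟩

theorem AscendsForever.exists_seq {x : X} (h : AscendsForever x) :
    ∃ s : ℕ → X, s 0 = x ∧ ∀ k, s k ⋖ s (k + 1) := by
  choose nxt hnxt using h
  let t : ℕ → {y : X // ReflTransGen (· ⋖ ·) x y} := fun n =>
    Nat.rec ⟨x, .refl⟩ (fun _ y => ⟨nxt y.1 y.2, y.2.tail (hnxt y.1 y.2)⟩) n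
  exact ⟨fun n => (t n).1, rfl, fun k => hnxt _ _⟩

theorem DescendsForever.exists_seq {x : X} (h : DescendsForever x) :
    ∃ s : ℕ → X, s 0 = x ∧ ∀ k, s (k + 1) ⋖ s k := by
  obtain ⟨s, h0, hs⟩ := (ascendsForever_toDual.2 h).exists_seq
  exact ⟨fun k => OrderDual.ofDual (s k), h0, fun k => ofDual_covBy_ofDual_iff.2 (hs k)⟩

/-- An initial segment of type `ω`. -/
theorem AscendsForever.hasBasicSuborder_of_isMin {x : X} (h : AscendsForever x) (hx : IsMin x) :
    HasBasicSuborder X := by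
  obtain ⟨s, rfl, hs⟩ := h.exists_seq
  refine HasBasicSuborder.of_embedding
    (OrderEmbedding.ofStrictMono s (strictMono_nat_of_lt_succ fun k => (hs k).lt))
    ⟨?_, ?_, ?_⟩ (Or.inr <| Or.inl ⟨OrderIso.refl ℕ⟩)
  · intro a b hab
    rw [Order.covBy_iff_add_one_eq] at hab
    exact hab ▸ hs a
  · intro a ha
    rw [isMin_iff_eq_bot] at ha
    rw [ha]
    exact hx
  · intro a ha
    exact absurd ha (not_isMax a)

/-- A convex copy of `ζ`. -/
theorem AscendsForever.hasBasicSuborder_of_descendsForever {x : X} (h : AscendsForever x)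
    (h' : DescendsForever x) : HasBasicSuborder X := by
  obtain ⟨s, hs0, hs⟩ := h.exists_seq
  obtain ⟨t, ht0, ht⟩ := h'.exists_seq
  let g : ℤ → X := fun n => Int.casesOn n s (fun k => t (k + 1))
  have hg : ∀ n, g n ⋖ g (n + 1) := by
    rintro (k | _ | k)
    · exact hs k
    · have := ht 0
      rw [ht0, ← hs0] at this
      exact this
    · exact ht (k + 1)
  refine HasBasicSuborder.of_embedding
    (OrderEmbedding.ofStrictMono g (strictMono_int_of_lt_succ fun k => (hg k).lt))
    ⟨?_, ?_, ?_⟩ (Or.inl ⟨OrderIso.refl ℤ⟩)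
  · intro a b hab
    rw [Order.covBy_iff_add_one_eq] at hab
    exact hab ▸ hg a
  · intro a ha
    exact absurd ha (not_isMin a)
  · intro a ha
    exact absurd ha (not_isMax a)

/-- A descending sequence of successor chains, each starting at a point without immediate
predecessor, is a suborder of type `ω·ω*`. -/
theorem hasBasicSuborder_of_ascending_chains {U : Set X} (hne : U.Nonempty)
    (hU : ∀ x ∈ U, AscendsForever x ∧ ∀ z, ¬ z ⋖ x) (hlt : ∀ x ∈ U, ∃ y ∈ U, y < x) :
    HasBasicSuborder X := by
  choose! nxt hnxtU hnxt using hlt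
  obtain ⟨x₀, hx₀⟩ := hne
  have hmem : ∀ n, nxt^[n] x₀ ∈ U := fun n => by
    induction n with
    | zero => exact hx₀
    | succ n ih => rw [Function.iterate_succ_apply']; exact hnxtU _ ih
  have hanti : StrictAnti fun n => nxt^[n] x₀ := strictAnti_nat_of_succ_lt fun n => by
    rw [Function.iterate_succ_apply']; exact hnxt _ (hmem n)
  choose s hs0 hs using fun n => (hU _ (hmem n)).1.exists_seq
  have hsm : ∀ n, StrictMono (s n) := fun n => strictMono_nat_of_lt_succ fun k => (hs n k).lt
  have hreach : ∀ n k, ReflTransGen (· ⋖ ·) (nxt^[n] x₀) (s n k) := fun n k => by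
    induction k with
    | zero => rw [hs0]
    | succ k ih => exact ih.tail (hs n k)
  have hlt : ∀ m n k l, n < m → s m k < s n l := fun m n k l hmn =>
    (lt_of_reflTransGen_covBy (hreach m k) (hU _ (hmem n)).2 (hanti hmn)).trans_le
      (le_of_reflTransGen_covBy (hreach n l))
  let f : ℕᵒᵈ ×ₗ ℕ → X := fun p => s (OrderDual.ofDual (ofLex p).1) (ofLex p).2
  have hf : StrictMono f := by
    intro p q hpq
    rcases Prod.Lex.lt_iff.1 hpq with h | ⟨h, h'⟩
    · exact hlt _ _ _ _ h
    · change s _ _ < s _ _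
      rw [h]
      exact hsm _ h'
  have hsucc : ∀ (n : ℕᵒᵈ) (k : ℕ) (b : ℕᵒᵈ ×ₗ ℕ), toLex (n, k) ⋖ b → b = toLex (n, k + 1) := by
    intro n k b hb
    by_contra hne
    refine hb.2 (c := toLex (n, k + 1)) (Prod.Lex.lt_iff.2 (Or.inr ⟨rfl, Nat.lt_succ_self k⟩)) ?_
    refine lt_of_le_of_ne ?_ (Ne.symm hne)
    rcases Prod.Lex.lt_iff.1 hb.lt with h | ⟨h, h'⟩
    · exact le_of_lt (Prod.Lex.lt_iff.2 (Or.inl h))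
    · exact Prod.Lex.le_iff.2 (Or.inr ⟨h, h'⟩)
  have : Infinite (ℕᵒᵈ ×ₗ ℕ) := Prod.infinite_of_right (α := ℕᵒᵈ) (β := ℕ)
  refine HasBasicSuborder.of_embedding (OrderEmbedding.ofStrictMono f hf) ⟨?_, ?_, ?_⟩
    (Or.inr <| Or.inr <| Or.inr <| Or.inl ⟨OrderIso.refl _⟩)
  · intro a b hab
    rw [hsucc (ofLex a).1 (ofLex a).2 b hab]
    exact hs _ _
  · intro a ha
    refine absurd ha fun h => not_isMin (ofLex a).1 ?_
    intro c hc
    by_contra hc'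
    exact (Prod.Lex.lt_iff.2 (Or.inl (lt_of_le_not_ge hc hc')) :
      toLex (c, (ofLex a).2) < a).not_ge (h (Prod.Lex.lt_iff.2
        (Or.inl (lt_of_le_not_ge hc hc')) : toLex (c, (ofLex a).2) < a).le)
  · intro a ha
    have : a < toLex ((ofLex a).1, (ofLex a).2 + 1) :=
      Prod.Lex.lt_iff.2 (Or.inr ⟨rfl, Nat.lt_succ_self _⟩)
    exact absurd (ha this.le) this.not_ge

theorem hasBasicSuborder_of_descending_chains {V : Set X} (hne : V.Nonempty)
    (hV : ∀ x ∈ V, DescendsForever x ∧ ∀ z, ¬ x ⋖ z) (hlt : ∀ x ∈ V, ∃ y ∈ V, x < y) :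
    HasBasicSuborder X :=
  .of_dual <| hasBasicSuborder_of_ascending_chains (X := Xᵒᵈ) (U := V) hne
    (fun x hx => ⟨(ascendsForever_toDual (X := X)).2 (hV x hx).1,
      fun z hz => (hV x hx).2 z (ofDual_covBy_ofDual_iff.2 hz)⟩) hlt

/-- In a convex set whose points all have finite successor and predecessor chains, the points
without immediate successor are densely ordered, which yields a copy of `η`. -/
theorem hasBasicSuborder_of_finite_chains {T : Set X} (hT : T.OrdConnected)
    (hup : ∀ x ∈ T, ¬ AscendsForever x) (hdown : ∀ x ∈ T, ¬ DescendsForever x)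
    {x y : X} (hx : x ∈ T) (hy : y ∈ T) (hx' : ∀ z, ¬ x ⋖ z) (hy' : ∀ z, ¬ y ⋖ z) (hxy : x < y) :
    HasBasicSuborder X := by
  let R : Set X := {x ∈ T | ∀ z, ¬ x ⋖ z}
  have : Nontrivial R := ⟨⟨⟨x, hx, hx'⟩, ⟨y, hy, hy'⟩, fun h => hxy.ne (congrArg Subtype.val h)⟩⟩
  have : DenselyOrdered R := by
    refine ⟨?_⟩
    rintro ⟨a, ha, ha'⟩ ⟨b, hb, hb'⟩ hab
    obtain ⟨c, hcb, hc⟩ := exists_bot_of_not_descendsForever (hdown b hb)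
    have hac : a < c := lt_of_covBy_reflTransGen hcb ha' hab
    obtain ⟨w, haw, hwc⟩ := (not_covBy_iff hac).1 (ha' c)
    have hcb' := le_of_reflTransGen_covBy hcb
    obtain ⟨t, hwt, ht⟩ := exists_top_of_not_ascendsForever
      (hup w (hT.out ha hb ⟨haw.le, hwc.le.trans hcb'⟩))
    have hat : a < t := haw.trans_le (le_of_reflTransGen_covBy hwt)
    have htb : t < b := (lt_of_reflTransGen_covBy hwt hc hwc).trans_le hcb'
    exact ⟨⟨t, hT.out ha hb ⟨hat.le, htb.le⟩, ht⟩, hat, htb⟩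
  obtain ⟨f⟩ := Order.embedding_from_countable_to_dense ℚ R
  refine HasBasicSuborder.of_embedding (f.trans (OrderEmbedding.subtype (· ∈ R))) ⟨?_, ?_, ?_⟩
    (Or.inr <| Or.inr <| Or.inr <| Or.inr <| Or.inr ⟨OrderIso.refl ℚ⟩)
  · intro a b hab
    obtain ⟨c, hac, hcb⟩ := exists_between hab.lt
    exact absurd hcb (hab.2 hac)
  · intro a ha
    exact absurd ha (not_isMin a)
  · intro a ha
    exact absurd ha (not_isMax a)

theorem exists_start_of_ascendsForever {x : X} (h : AscendsForever x) (h' : ¬ DescendsForever x) :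
    ∃ s, s ≤ x ∧ AscendsForever s ∧ ∀ z, ¬ z ⋖ s := by
  obtain ⟨s, hsx, hs⟩ := exists_bot_of_not_descendsForever h'
  exact ⟨s, le_of_reflTransGen_covBy hsx, h.of_reflTransGen hsx, hs⟩

theorem exists_end_of_descendsForever {x : X} (h : DescendsForever x) (h' : ¬ AscendsForever x) :
    ∃ s, ReflTransGen (· ⋖ ·) x s ∧ DescendsForever s ∧ ∀ z, ¬ s ⋖ z := by
  obtain ⟨s, hxs, hs⟩ := exists_top_of_not_ascendsForever h'
  refine ⟨s, hxs, ascendsForever_toDual.1 ?_, hs⟩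
  exact (ascendsForever_toDual.2 h).of_reflTransGen (reflTransGen_covBy_toDual.2 hxs)

/-- Barring the types `ζ`, `ω·ω*` and `ω`, there is a first successor chain of type `ω`, and it is
not initial. Barring `ω*·ω` too, the predecessor chains of type `ω*` below it have a last one, if
any. Between that one and the first successor chain all chains are finite. -/
theorem AscendsForever.hasBasicSuborder {x : X} (hx : AscendsForever x) : HasBasicSuborder X := by
  by_contra hcon
  have hnot : ∀ y : X, AscendsForever y → ¬ DescendsForever y := fun y h h' =>
    hcon (h.hasBasicSuborder_of_descendsForever h')
  obtain ⟨s, ⟨hsU, hsl⟩, hsmin⟩ : ∃ s ∈ {s : X | AscendsForever s ∧ ∀ z, ¬ z ⋖ s},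
      ∀ s' ∈ {s : X | AscendsForever s ∧ ∀ z, ¬ z ⋖ s}, s ≤ s' := by
    by_contra hc
    push Not at hc
    obtain ⟨s, -, h1, h2⟩ := exists_start_of_ascendsForever hx (hnot x hx)
    exact hcon (hasBasicSuborder_of_ascending_chains (U := {s : X | AscendsForever s ∧ ∀ z, ¬ z ⋖ s})
      ⟨s, h1, h2⟩ (fun _ h => h) hc)
  let V : Set X := {v | (DescendsForever v ∧ ∀ z, ¬ v ⋖ z) ∧ v < s}
  let T : Set X := {z | z < s ∧ ∀ v ∈ V, v < z}
  have hT : T.OrdConnected := ⟨fun a ha b hb z hz =>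
    ⟨hz.2.trans_lt hb.1, fun v hv => (ha.2 v hv).trans_le hz.1⟩⟩
  have hTup : ∀ z ∈ T, ¬ AscendsForever z := fun z hz hz' => by
    obtain ⟨s', hs'z, h1, h2⟩ := exists_start_of_ascendsForever hz' (hnot z hz')
    exact ((hsmin s' ⟨h1, h2⟩).trans hs'z).not_gt hz.1
  have hTdown : ∀ z ∈ T, ¬ DescendsForever z := fun z hz hz' => by
    obtain ⟨v, hzv, h1, h2⟩ := exists_end_of_descendsForever hz' (hTup z hz)
    have hvs := lt_of_reflTransGen_covBy hzv hsl hz.1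
    exact (hz.2 v ⟨⟨h1, h2⟩, hvs⟩).not_ge (le_of_reflTransGen_covBy hzv)
  have hTne : T.Nonempty := by
    by_cases hV : V.Nonempty
    · obtain ⟨r, hr, hrmax⟩ : ∃ r ∈ V, ∀ v ∈ V, v ≤ r := by
        by_contra hc
        push Not at hc
        exact hcon (hasBasicSuborder_of_descending_chains hV (fun _ h => h.1) hc)
      obtain ⟨z, hrz, hzs⟩ := (not_covBy_iff hr.2).1 (hsl r)
      exact ⟨z, hzs, fun v hv => (hrmax v hv).trans_lt hrz⟩
    · have : ¬ IsMin s := fun h => hcon (hsU.hasBasicSuborder_of_isMin h)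
      obtain ⟨z, hz⟩ := not_isMin_iff.1 this
      exact ⟨z, hz, fun v hv => absurd ⟨v, hv⟩ hV⟩
  have htop : ∀ z ∈ T, ∃ t ∈ T, z ≤ t ∧ ∀ u, ¬ t ⋖ u := fun z hz => by
    obtain ⟨t, hzt, ht⟩ := exists_top_of_not_ascendsForever (hTup z hz)
    have := le_of_reflTransGen_covBy hzt
    exact ⟨t, ⟨lt_of_reflTransGen_covBy hzt hsl hz.1,
      fun v hv => (hz.2 v hv).trans_le this⟩, this, ht⟩
  obtain ⟨z, hz⟩ := hTne
  obtain ⟨t, htT, -, ht⟩ := htop z hz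
  obtain ⟨z', htz', hz's⟩ := (not_covBy_iff htT.1).1 (hsl t)
  obtain ⟨t', htT', hzt', ht'⟩ := htop z' ⟨hz's, fun v hv => (htT.2 v hv).trans htz'⟩
  exact hcon (hasBasicSuborder_of_finite_chains hT hTup hTdown htT htT' ht ht'
    (htz'.trans_le hzt'))

theorem finite_Icc_of_reflTransGen_covBy {a b : X} (h : ReflTransGen (· ⋖ ·) a b) :
    (Set.Icc a b).Finite := by
  induction h with
  | refl => simp
  | @tail c d _ h ih =>
    refine (ih.insert d).subset fun x hx => ?_
    rcases hx.2.eq_or_lt with rfl | hxd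
    · exact Set.mem_insert _ _
    · exact Set.mem_insert_of_mem _ ⟨hx.1, h.le_of_lt hxd⟩

theorem hasBasicSuborder (X : Type*) [LinearOrder X] [Infinite X] : HasBasicSuborder X := by
  by_cases hU : ∃ x : X, AscendsForever x
  · exact hU.choose_spec.hasBasicSuborder
  by_cases hV : ∃ x : X, DescendsForever x
  · exact (ascendsForever_toDual.2 hV.choose_spec).hasBasicSuborder.of_dual
  push Not at hU hV
  obtain ⟨m, -, hm⟩ := exists_top_of_not_ascendsForever (hU (Classical.arbitrary X))
  by_cases htop : ∃ t, t ≠ m ∧ ∀ z, ¬ t ⋖ z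
  · obtain ⟨t, htm, ht⟩ := htop
    rcases lt_or_gt_of_ne htm with h | h
    · exact hasBasicSuborder_of_finite_chains Set.ordConnected_univ (fun x _ => hU x)
        (fun x _ => hV x) trivial trivial ht hm h
    · exact hasBasicSuborder_of_finite_chains Set.ordConnected_univ (fun x _ => hU x)
        (fun x _ => hV x) trivial trivial hm ht h
  -- a single finite chain would exhaust `X`
  · push Not at htop
    exfalso
    have hreach : ∀ x, ReflTransGen (· ⋖ ·) x m := fun x => by
      obtain ⟨t, hxt, ht⟩ := exists_top_of_not_ascendsForever (hU x)
      by_cases h : t = m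
      · exact h ▸ hxt
      · obtain ⟨z, hz⟩ := htop t h
        exact absurd hz (ht z)
    obtain ⟨b, hbm, hb⟩ := exists_bot_of_not_descendsForever (hV m)
    refine Set.infinite_univ (α := X)
      ((finite_Icc_of_reflTransGen_covBy hbm).subset fun x _ => ⟨?_, ?_⟩)
    · by_contra hc
      exact (lt_of_reflTransGen_covBy (hreach x) hb (not_le.1 hc)).not_ge
        (le_of_reflTransGen_covBy hbm)
    · exact le_of_reflTransGen_covBy (hreach x)

end Chains

/-! ### Primitive recursive copies of the basic orders -/

/-- The order is isomorphic to a primitive recursive ordering of all of `ℕ`. -/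
def HasPrimrecCopy (B : Type*) [LinearOrder B] : Prop :=
  ∃ b : ℕ ≃ B, PrimrecRel fun x y => b x ≤ b y

theorem HasPrimrecCopy.of_orderIso {B C : Type*} [LinearOrder B] [LinearOrder C] (e : B ≃o C)
    (h : HasPrimrecCopy B) : HasPrimrecCopy C := by
  obtain ⟨b, hb⟩ := h
  exact ⟨b.trans e.toEquiv, hb.of_eq fun x y => (e.le_iff_le).symm⟩

theorem HasPrimrecCopy.dual {B : Type*} [LinearOrder B] (h : HasPrimrecCopy B) :
    HasPrimrecCopy Bᵒᵈ := by
  obtain ⟨b, hb⟩ := h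
  exact ⟨b.trans OrderDual.toDual, hb.swap⟩

theorem hasPrimrecCopy_nat : HasPrimrecCopy ℕ :=
  ⟨Equiv.refl ℕ, Primrec.nat_le⟩

/-- Even codes give the nonnegative integers, odd codes the negative ones. -/
theorem hasPrimrecCopy_int : HasPrimrecCopy ℤ := by
  let g : ℕ → ℤ := fun n => if n % 2 = 0 then (n / 2 : ℕ) else -((n / 2 : ℕ) : ℤ) - 1
  have hg : Function.Bijective g := by
    constructor
    · intro a b hab
      simp only [g] at hab
      split_ifs at hab <;> omega
    · intro z
      rcases le_or_gt 0 z with hz | hz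
      · refine ⟨2 * z.toNat, ?_⟩
        simp only [g]
        split_ifs <;> omega
      · refine ⟨2 * (-z - 1).toNat + 1, ?_⟩
        simp only [g]
        split_ifs <;> omega
  refine ⟨Equiv.ofBijective g hg, ?_⟩
  have h1 : PrimrecPred fun p : ℕ × ℕ => p.1 % 2 = 0 :=
    Primrec.eq.comp (Primrec.nat_mod.comp .fst (.const 2)) (.const 0)
  have h2 : PrimrecPred fun p : ℕ × ℕ => p.2 % 2 = 0 :=
    Primrec.eq.comp (Primrec.nat_mod.comp .snd (.const 2)) (.const 0)
  have h3 : PrimrecPred fun p : ℕ × ℕ => p.1 ≤ p.2 := Primrec.nat_le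
  have h4 : PrimrecPred fun p : ℕ × ℕ => p.2 ≤ p.1 := Primrec.nat_le.swap
  refine PrimrecPred.of_eq
    ((h1.and (h2.and h3)).or ((h1.not.and h2).or (h1.not.and (h2.not.and h4)))) fun p => ?_
  simp only [Equiv.ofBijective_apply, g]
  split_ifs <;> omega

/-- The pairs `(a, n)` with the larger `a` first, coded by the pairing function. -/
theorem hasPrimrecCopy_dual_lex : HasPrimrecCopy (ℕᵒᵈ ×ₗ ℕ) := by
  refine ⟨Nat.pairEquiv.symm.trans ((Equiv.prodCongrLeft fun _ => OrderDual.toDual).trans toLex), ?_⟩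
  have f1 : Primrec fun p : ℕ × ℕ => p.1.unpair.1 := Primrec.fst.comp (Primrec.unpair.comp .fst)
  have f2 : Primrec fun p : ℕ × ℕ => p.1.unpair.2 := Primrec.snd.comp (Primrec.unpair.comp .fst)
  have f3 : Primrec fun p : ℕ × ℕ => p.2.unpair.1 := Primrec.fst.comp (Primrec.unpair.comp .snd)
  have f4 : Primrec fun p : ℕ × ℕ => p.2.unpair.2 := Primrec.snd.comp (Primrec.unpair.comp .snd)
  refine PrimrecPred.of_eq ((Primrec.nat_lt.comp f3 f1).or
    ((Primrec.eq.comp f1 f3).and (Primrec.nat_le.comp f2 f4))) fun p => ?_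
  exact (Prod.Lex.le_iff (α := ℕᵒᵈ) (β := ℕ)).symm

/-- The positive dyadic rationals `(2a + 1) / 2 ^ n`, each of them written in lowest terms, form a
copy of `η`. -/
theorem hasPrimrecCopy_rat : HasPrimrecCopy ℚ := by
  let g : ℕ → ℚ := fun x => (2 * x.unpair.1 + 1 : ℕ) / (2 : ℚ) ^ x.unpair.2
  have hle : ∀ x y, g x ≤ g y ↔
      (2 * x.unpair.1 + 1) * 2 ^ y.unpair.2 ≤ (2 * y.unpair.1 + 1) * 2 ^ x.unpair.2 := by
    intro x y
    simp only [g]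
    rw [div_le_div_iff₀ (by positivity) (by positivity)]
    exact_mod_cast Iff.rfl
  have hodd : ∀ a b m n : ℕ, (2 * a + 1) * 2 ^ n = (2 * b + 1) * 2 ^ m → m ≤ n → a = b ∧ m = n := by
    intro a b m n h hmn
    obtain ⟨k, rfl⟩ := Nat.exists_eq_add_of_le hmn
    have h' : (2 * a + 1) * 2 ^ k = 2 * b + 1 := by
      refine Nat.eq_of_mul_eq_mul_right (pow_pos two_pos m) ?_
      rw [← h, pow_add]; ring
    cases k with
    | zero => simp at h'; exact ⟨h', rfl⟩
    | succ k =>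
      rw [pow_succ, ← mul_assoc] at h'
      omega
  have hinj : Function.Injective g := by
    intro x y hxy
    have h := le_antisymm ((hle x y).1 hxy.le) ((hle y x).1 hxy.ge)
    have : x.unpair = y.unpair := by
      rcases le_total x.unpair.2 y.unpair.2 with hl | hl
      · obtain ⟨h1, h2⟩ := hodd _ _ _ _ h hl
        exact Prod.ext h1 h2
      · obtain ⟨h1, h2⟩ := hodd _ _ _ _ h.symm hl
        exact Prod.ext h1.symm h2.symm
    rw [← Nat.pair_unpair x, this, Nat.pair_unpair]
  have hgp : ∀ a n, g (Nat.pair a n) = (2 * a + 1 : ℕ) / (2 : ℚ) ^ n := by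
    intro a n
    simp only [g, Nat.unpair_pair]
  let R : Set ℚ := Set.range g
  have : Nonempty R := ⟨⟨g 0, 0, rfl⟩⟩
  have : NoMinOrder R := by
    refine ⟨?_⟩
    rintro ⟨_, x, rfl⟩
    refine ⟨⟨_, Nat.pair 0 (x.unpair.2 + 1), rfl⟩, Subtype.mk_lt_mk.2 ?_⟩
    rw [hgp, div_lt_div_iff₀ (by positivity) (by positivity), pow_succ]
    have : (0 : ℚ) < 2 ^ x.unpair.2 := by positivity
    push_cast
    nlinarith [mul_nonneg (Nat.cast_nonneg x.unpair.1 : (0 : ℚ) ≤ _) this.le]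
  have : NoMaxOrder R := by
    refine ⟨?_⟩
    rintro ⟨_, x, rfl⟩
    refine ⟨⟨_, Nat.pair (x.unpair.1 + 1) x.unpair.2, rfl⟩, Subtype.mk_lt_mk.2 ?_⟩
    rw [hgp]
    refine div_lt_div_of_pos_right ?_ (by positivity)
    exact_mod_cast (by omega : 2 * x.unpair.1 + 1 < 2 * (x.unpair.1 + 1) + 1)
  have : DenselyOrdered R := by
    refine ⟨?_⟩
    rintro ⟨_, x, rfl⟩ ⟨_, y, rfl⟩ hxy
    have hxy' : g x < g y := hxy
    -- over the common denominator `2 ^ m` the numerators are `A < B`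
    obtain ⟨m, A, B, hA, hB⟩ : ∃ m A B : ℕ, g x = A / (2 : ℚ) ^ m ∧ g y = B / (2 : ℚ) ^ m := by
      refine ⟨x.unpair.2 + y.unpair.2, (2 * x.unpair.1 + 1) * 2 ^ y.unpair.2,
        (2 * y.unpair.1 + 1) * 2 ^ x.unpair.2, ?_, ?_⟩ <;>
      · simp only [g, pow_add]
        push_cast
        field_simp
    have hAB : A < B := by
      rw [hA, hB, div_lt_div_iff_of_pos_right (by positivity)] at hxy'
      exact_mod_cast hxy'
    refine ⟨⟨_, Nat.pair A (m + 1), rfl⟩, Subtype.mk_lt_mk.2 ?_, Subtype.mk_lt_mk.2 ?_⟩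
    · rw [hgp, hA, div_lt_div_iff₀ (by positivity) (by positivity), pow_succ]
      have : (0 : ℚ) < 2 ^ m := by positivity
      push_cast
      nlinarith
    · rw [hgp, hB, div_lt_div_iff₀ (by positivity) (by positivity), pow_succ]
      have : (0 : ℚ) < 2 ^ m := by positivity
      have : (A : ℚ) + 1 ≤ B := by exact_mod_cast hAB
      push_cast
      nlinarith
  obtain ⟨e⟩ := Order.iso_of_countable_dense R ℚ
  refine HasPrimrecCopy.of_orderIso e ⟨Equiv.ofInjective g hinj, ?_⟩
  have f1 : Primrec fun p : ℕ × ℕ => p.1.unpair.1 := Primrec.fst.comp (Primrec.unpair.comp .fst)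
  have f2 : Primrec fun p : ℕ × ℕ => p.1.unpair.2 := Primrec.snd.comp (Primrec.unpair.comp .fst)
  have f3 : Primrec fun p : ℕ × ℕ => p.2.unpair.1 := Primrec.fst.comp (Primrec.unpair.comp .snd)
  have f4 : Primrec fun p : ℕ × ℕ => p.2.unpair.2 := Primrec.snd.comp (Primrec.unpair.comp .snd)
  have hpow : Primrec₂ ((· ^ ·) : ℕ → ℕ → ℕ) := Primrec₂.unpaired'.1 Nat.Primrec.pow
  have hnum : ∀ {u v : ℕ × ℕ → ℕ}, Primrec u → Primrec v →
      Primrec fun p => (2 * u p + 1) * 2 ^ v p := fun hu hv =>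
    Primrec.nat_mul.comp (Primrec.succ.comp (Primrec.nat_mul.comp (.const 2) hu))
      (hpow.comp (.const 2) hv)
  exact PrimrecPred.of_eq (Primrec.nat_le.comp (hnum f1 f4) (hnum f3 f2)) fun p => (hle _ _).symm

theorem IsBasicOrder.hasPrimrecCopy {B : Type*} [LinearOrder B] (h : IsBasicOrder B) :
    HasPrimrecCopy B := by
  rcases h with ⟨⟨i⟩⟩ | ⟨⟨i⟩⟩ | ⟨⟨i⟩⟩ | ⟨⟨i⟩⟩ | ⟨⟨i⟩⟩ | ⟨⟨i⟩⟩
  · exact hasPrimrecCopy_int.of_orderIso i.symm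
  · exact hasPrimrecCopy_nat.of_orderIso i.symm
  · exact hasPrimrecCopy_nat.dual.of_orderIso i.symm
  · exact hasPrimrecCopy_dual_lex.of_orderIso i.symm
  · exact hasPrimrecCopy_dual_lex.dual.of_orderIso ((lexProdDual ℕᵒᵈ ℕ).trans i.symm)
  · exact hasPrimrecCopy_rat.of_orderIso i.symm

theorem noMaxOrder_dual_lex : NoMaxOrder (ℕᵒᵈ ×ₗ ℕ) :=
  ⟨fun a => ⟨toLex ((ofLex a).1, (ofLex a).2 + 1),
    Prod.Lex.lt_iff.2 (Or.inr ⟨rfl, Nat.lt_succ_self _⟩)⟩⟩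

/-- No basic order has both a least and a greatest element. -/
theorem IsBasicOrder.noMinOrder_or_noMaxOrder {B : Type*} [LinearOrder B] (h : IsBasicOrder B) :
    NoMinOrder B ∨ NoMaxOrder B := by
  have hmax : ∀ {C : Type} [LinearOrder C] [NoMaxOrder C], B ≃o C → NoMaxOrder B := fun i =>
    ⟨fun a => (exists_gt (i a)).imp' i.symm fun c hc => by rwa [i.lt_symm_apply]⟩
  have hmin : ∀ {C : Type} [LinearOrder C] [NoMinOrder C], B ≃o C → NoMinOrder B := fun i =>
    ⟨fun a => (exists_lt (i a)).imp' i.symm fun c hc => by rwa [i.symm_apply_lt]⟩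
  have := noMaxOrder_dual_lex
  rcases h with ⟨⟨i⟩⟩ | ⟨⟨i⟩⟩ | ⟨⟨i⟩⟩ | ⟨⟨i⟩⟩ | ⟨⟨i⟩⟩ | ⟨⟨i⟩⟩
  · exact Or.inr (hmax i)
  · exact Or.inr (hmax i)
  · exact Or.inl (hmin i)
  · exact Or.inr (hmax i)
  · exact Or.inl (hmin (i.trans (lexProdDual ℕᵒᵈ ℕ).symm))
  · exact Or.inr (hmax i)

/-! ### Dense sets of natural numbers with a prescribed complement -/

theorem hasDensityOne_of_compl_subset {D : Set ℕ} (F : ℕ → Finset ℕ)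
    (hF : ∀ n, ∀ x ≤ n, x ∉ D → x ∈ F n)
    (hlim : Tendsto (fun n : ℕ => ((F n).card : ℝ) / ((n : ℝ) + 1)) atTop (𝓝 0)) :
    HasDensityOne D := by
  classical
  have hD : ∀ n : ℕ, (((Finset.range (n + 1)).filter (· ∈ D)).card : ℝ) / ((n : ℝ) + 1) =
      1 - (((Finset.range (n + 1)).filter (· ∉ D)).card : ℝ) / ((n : ℝ) + 1) := by
    intro n
    have h : (((Finset.range (n + 1)).filter (· ∈ D)).card : ℝ) +
        ((Finset.range (n + 1)).filter (· ∉ D)).card = (n : ℝ) + 1 := by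
      have := Finset.card_filter_add_card_filter_not (s := Finset.range (n + 1)) (· ∈ D)
      rw [Finset.card_range] at this
      exact_mod_cast this
    have hn : (n : ℝ) + 1 ≠ 0 := by positivity
    field_simp
    linarith
  have h0 : Tendsto (fun n : ℕ =>
      (((Finset.range (n + 1)).filter (· ∉ D)).card : ℝ) / ((n : ℝ) + 1)) atTop (𝓝 0) := by
    refine squeeze_zero (fun n => by positivity) (fun n => ?_) hlim
    refine div_le_div_of_nonneg_right ?_ (by positivity)
    refine Nat.cast_le.2 (Finset.card_le_card fun x hx => ?_)
    rw [Finset.mem_filter, Finset.mem_range] at hx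
    exact hF n x (by omega) hx.2
  unfold HasDensityOne
  have h1 := h0.const_sub 1
  rw [sub_zero] at h1
  refine h1.congr fun n => ?_
  rw [← hD n]

/-- There is a primitive recursive set `D` of density one, with a primitive recursive map that
restricts to a bijection of `D` with `ℕ`, whose complement has any prescribed countable size. Finite
complements are initial segments of `ℕ`; the infinite one is the set of squares, which
are the codes `b * b` of the pairs `(0, b)`. -/
theorem exists_dense_set (κ : Type*) [Countable κ] :
    ∃ (D : Set ℕ) (i : ℕ → ℕ), HasDensityOne D ∧ PrimrecPred (· ∈ D) ∧ Primrec i ∧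
      Set.BijOn i D Set.univ ∧ Nonempty (κ ≃ (Dᶜ : Set ℕ)) := by
  rcases finite_or_infinite κ with hκ | hκ
  · refine ⟨{x | Nat.card κ ≤ x}, fun x => x - Nat.card κ, ?_, ?_, ?_, ?_, ?_⟩
    · refine hasDensityOne_of_compl_subset (fun _ => Finset.range (Nat.card κ)) (fun n x _ hx => ?_) ?_
      · simpa using hx
      · exact tendsto_const_nhds.div_atTop
          (tendsto_atTop_add_const_right _ _ tendsto_natCast_atTop_atTop)
    · exact Primrec.nat_le.comp (.const _) .id
    · exact Primrec.nat_sub.comp .id (.const _)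
    · refine ⟨fun _ _ => trivial, fun x hx y hy hxy => ?_, fun y _ => ?_⟩
      · simp only [Set.mem_ofPred_eq] at hx hy hxy
        omega
      · exact ⟨y + Nat.card κ, by simp, by simp⟩
    · have : ({x | Nat.card κ ≤ x}ᶜ : Set ℕ) = {x | x < Nat.card κ} := by
        ext x; simp
      rw [this]
      exact ⟨(Finite.equivFin κ).trans Fin.equivSubtype⟩
  · refine ⟨{x | x.unpair.1 ≠ 0}, fun x => Nat.pair (x.unpair.1 - 1) x.unpair.2, ?_, ?_, ?_, ?_, ?_⟩
    · refine hasDensityOne_of_compl_subset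
        (fun n => (Finset.range (Nat.sqrt n + 1)).image (Nat.pair 0)) (fun n x hxn hx => ?_) ?_
      · have hx : x.unpair.1 = 0 := not_not.1 hx
        have h := Nat.pair_unpair x
        rw [hx] at h
        refine Finset.mem_image.2 ⟨x.unpair.2, Finset.mem_range.2 ?_, h⟩
        have h' : x.unpair.2 * x.unpair.2 = x := by
          unfold Nat.pair at h
          split_ifs at h with h0
          · exact h
          · have : x.unpair.2 = 0 := by omega
            rw [this] at h ⊢
            exact h
        have : x.unpair.2 ≤ Nat.sqrt n := Nat.le_sqrt.2 (by omega)
        omega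
      · have hs : Tendsto (fun n : ℕ => 2 / Real.sqrt ((n : ℝ) + 1)) atTop (𝓝 0) :=
          tendsto_const_nhds.div_atTop (Real.tendsto_sqrt_atTop.comp
            (tendsto_atTop_add_const_right _ _ tendsto_natCast_atTop_atTop))
        refine squeeze_zero (fun n => by positivity) (fun n => ?_) hs
        have hcard : (((Finset.range (Nat.sqrt n + 1)).image (Nat.pair 0)).card : ℝ) ≤
            Nat.sqrt n + 1 := by
          exact_mod_cast Finset.card_image_le.trans_eq (Finset.card_range _)
        have hsqrt : (Nat.sqrt n : ℝ) ≤ Real.sqrt n := Real.nat_sqrt_le_real_sqrt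
        have hpos : (0 : ℝ) < (n : ℝ) + 1 := by positivity
        rw [div_le_div_iff₀ hpos (Real.sqrt_pos.2 hpos)]
        have h1 : Real.sqrt n ≤ Real.sqrt ((n : ℝ) + 1) := Real.sqrt_le_sqrt (by linarith)
        have h2 : 1 ≤ Real.sqrt ((n : ℝ) + 1) := Real.one_le_sqrt.2 (by
          have : (0 : ℝ) ≤ n := by positivity
          linarith)
        nlinarith [Real.mul_self_sqrt hpos.le]
    · exact (Primrec.eq.comp (Primrec.fst.comp Primrec.unpair) (.const 0)).not
    · exact Primrec₂.natPair.comp (Primrec.pred.comp (Primrec.fst.comp Primrec.unpair))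
        (Primrec.snd.comp Primrec.unpair)
    · refine ⟨fun _ _ => trivial, fun x hx y hy hxy => ?_, fun y _ => ?_⟩
      · simp only [Set.mem_ofPred_eq] at hx hy
        obtain ⟨h1, h2⟩ := Nat.pair_eq_pair.1 hxy
        rw [← Nat.pair_unpair x, ← Nat.pair_unpair y, h2, show x.unpair.1 = y.unpair.1 by omega]
      · exact ⟨Nat.pair (y.unpair.1 + 1) y.unpair.2, by simp, by simp⟩
    · have : Infinite ({x : ℕ | x.unpair.1 ≠ 0}ᶜ : Set ℕ) :=
        Infinite.of_injective (fun b : ℕ => ⟨Nat.pair 0 b, by simp⟩) fun a b hab =>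
          (Nat.pair_eq_pair.1 (congrArg Subtype.val hab)).2
      obtain ⟨e₁⟩ := nonempty_denumerable κ
      obtain ⟨e₂⟩ := nonempty_denumerable ({x : ℕ | x.unpair.1 ≠ 0}ᶜ : Set ℕ)
      exact ⟨Denumerable.equiv₂ _ _⟩

/-! ### Structures on `ℕ` and the two kinds of copies -/

section Copies

open FirstOrder.Language FirstOrder.Language.Structure

/-- The structure for the language of orders obtained by pulling `≤` back along a map. -/
abbrev pullbackOrderStructure {M β : Type*} [LE β] (q : M → β) :
    FirstOrder.Language.order.Structure M where
  funMap f := isEmptyElim f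
  RelMap {n} R := match n, R with
    | _, orderRel.le => fun v => q (v 0) ≤ q (v 1)

/-- In a relational language every set is the universe of a substructure. -/
def substructureOfSet {M : Type*} [FirstOrder.Language.order.Structure M] (S : Set M) :
    FirstOrder.Language.order.Substructure M where
  carrier := S
  fun_mem f := isEmptyElim f

theorem isCESubstructure_of_primrec [FirstOrder.Language.order.Structure ℕ]
    {B : FirstOrder.Language.order.Substructure ℕ} (hB : PrimrecPred (· ∈ B)) {R : ℕ → ℕ → Prop}
    (hR : PrimrecRel R) (h : ∀ v : Fin 2 → ℕ, (∀ i, v i ∈ B) →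
      (RelMap (L := FirstOrder.Language.order) leSymb v ↔ R (v 0) (v 1))) :
    IsCESubstructure B := by
  refine ⟨hB.computablePred.to_re, ?_, fun k f => isEmptyElim f⟩
  rintro _ ⟨⟩
  have f0 : Primrec fun v : Fin 2 → ℕ => v 0 := Primrec.fin_app.comp .id (.const 0)
  have f1 : Primrec fun v : Fin 2 → ℕ => v 1 := Primrec.fin_app.comp .id (.const 1)
  refine REPred.of_eq
    (((hB.comp f0).and (hB.comp f1)).and (hR.comp f0 f1)).computablePred.to_re fun v => ?_
  rw [← Fin.forall_fin_two (p := fun i => v i ∈ B)]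
  exact and_congr_right fun hv => (h v hv).symm

theorem PreservesGaps.inlₗ {α β : Type*} [LinearOrder α] [LinearOrder β] [NoMaxOrder α] :
    PreservesGaps (OrderEmbedding.ofStrictMono _ (Sum.Lex.inl_strictMono (α := α) (β := β))) := by
  refine ⟨?_, ?_, fun {a} ha => absurd ha (not_isMax a)⟩
  · intro a b hab
    refine ⟨Sum.Lex.inl_strictMono hab.lt, fun c hac hcb => ?_⟩
    rcases c with c | c
    · exact hab.2 (Sum.Lex.inl_lt_inl_iff.1 hac) (Sum.Lex.inl_lt_inl_iff.1 hcb)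
    · exact absurd hcb Sum.Lex.not_inr_lt_inl
  · intro a ha c hc
    rcases c with c | c
    · exact Sum.Lex.inl_le_inl_iff.2 (ha (Sum.Lex.inl_le_inl_iff.1 hc))
    · exact absurd hc Sum.Lex.not_inr_le_inl

theorem PreservesGaps.inrₗ {α β : Type*} [LinearOrder α] [LinearOrder β] [NoMinOrder α] :
    PreservesGaps (OrderEmbedding.ofStrictMono _ (Sum.Lex.inr_strictMono (α := β) (β := α))) := by
  refine ⟨?_, fun {a} ha => absurd ha (not_isMin a), ?_⟩
  · intro a b hab
    refine ⟨Sum.Lex.inr_strictMono hab.lt, fun c hac hcb => ?_⟩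
    rcases c with c | c
    · exact absurd hac Sum.Lex.not_inr_lt_inl
    · exact hab.2 (Sum.Lex.inr_lt_inr_iff.1 hac) (Sum.Lex.inr_lt_inr_iff.1 hcb)
  · intro a ha c hc
    rcases c with c | c
    · exact absurd hc Sum.Lex.not_inr_le_inl
    · exact Sum.Lex.inr_le_inr_iff.2 (ha (Sum.Lex.inr_le_inr_iff.1 hc))

/-- A primitive recursive order on `D` without greatest or without least element extends to a
primitive recursive order on `ℕ`, by putting the complement of `D` on top or at the bottom. -/
theorem exists_primrec_extension.{u} {B : Type u} [LinearOrder B] (hB : NoMinOrder B ∨ NoMaxOrder B)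
    {D : Set ℕ} (hD : PrimrecPred (· ∈ D)) (p : D ≃ B) {R : ℕ → ℕ → Prop} (hR : PrimrecRel R)
    (hpR : ∀ x y : D, p x ≤ p y ↔ R x y) :
    ∃ (β : Type u) (_ : LinearOrder β) (f : B ↪o β) (q : ℕ → β), PreservesGaps f ∧
      Function.Injective q ∧ (∀ x : D, q x = f (p x)) ∧ PrimrecRel fun x y => q x ≤ q y := by
  classical
  have d1 : PrimrecPred fun z : ℕ × ℕ => z.1 ∈ D := hD.comp .fst
  have d2 : PrimrecPred fun z : ℕ × ℕ => z.2 ∈ D := hD.comp .snd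
  have hR' : PrimrecPred fun z : ℕ × ℕ => R z.1 z.2 := hR
  have hle : PrimrecPred fun z : ℕ × ℕ => z.1 ≤ z.2 := Primrec.nat_le
  rcases hB with hB | hB
  · let q : ℕ → ℕ ⊕ₗ B := fun x => if h : x ∈ D then Sum.inrₗ (p ⟨x, h⟩) else Sum.inlₗ x
    refine ⟨ℕ ⊕ₗ B, inferInstance, _, q, PreservesGaps.inrₗ, ?_, ?_, ?_⟩
    · intro x y hxy
      simp only [q] at hxy
      split_ifs at hxy with hx hy hy
      · exact congrArg Subtype.val (p.injective (Sum.inr_injective (toLex.injective hxy)))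
      · exact absurd (toLex.injective hxy) Sum.inr_ne_inl
      · exact absurd (toLex.injective hxy) Sum.inl_ne_inr
      · exact Sum.inl_injective (toLex.injective hxy)
    · intro x
      simp only [q, x.2, dite_true]
      rfl
    · refine PrimrecPred.of_eq ((d1.and (d2.and hR')).or
        ((d1.not.and d2).or (d1.not.and (d2.not.and hle)))) ?_
      rintro ⟨x, y⟩
      by_cases hx : x ∈ D <;> by_cases hy : y ∈ D <;>
        simp [q, hx, hy, ← hpR ⟨x, _⟩ ⟨y, _⟩, Sum.inlₗ, Sum.inrₗ]
  · let q : ℕ → B ⊕ₗ ℕ := fun x => if h : x ∈ D then Sum.inlₗ (p ⟨x, h⟩) else Sum.inrₗ x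
    refine ⟨B ⊕ₗ ℕ, inferInstance, _, q, PreservesGaps.inlₗ, ?_, ?_, ?_⟩
    · intro x y hxy
      simp only [q] at hxy
      split_ifs at hxy with hx hy hy
      · exact congrArg Subtype.val (p.injective (Sum.inl_injective (toLex.injective hxy)))
      · exact absurd (toLex.injective hxy) Sum.inl_ne_inr
      · exact absurd (toLex.injective hxy) Sum.inr_ne_inl
      · exact Sum.inr_injective (toLex.injective hxy)
    · intro x
      simp only [q, x.2, dite_true]
      rfl
    · refine PrimrecPred.of_eq ((d1.and (d2.and hR')).or
        ((d1.and d2.not).or (d1.not.and (d2.not.and hle)))) ?_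
      rintro ⟨x, y⟩
      by_cases hx : x ∈ D <;> by_cases hy : y ∈ D <;>
        simp [q, hx, hy, ← hpR ⟨x, _⟩ ⟨y, _⟩, Sum.inlₗ, Sum.inrₗ]

/-- The copy of `X` on `ℕ` puts the suborder `S` on a dense primitive recursive set, in a primitive
recursive way, and the rest of `X` on the complement, in an arbitrary way. -/
theorem hasCECopies_of_basicSuborder {X : Type*} [LinearOrder X] [Countable X] {S : Set X}
    (hinf : S.Infinite) (hS : PreservesGaps (Subtype.val : S → X)) (hb : IsBasicOrder S) :
    letI : FirstOrder.Language.order.Structure X := FirstOrder.Language.orderStructure X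
    HasSigmaGenericallyCECopy FirstOrder.Language.order 1 X ∧
      HasSigmaCoarselyCECopy FirstOrder.Language.order 1 X := by
  classical
  let sX : FirstOrder.Language.order.Structure X := FirstOrder.Language.orderStructure X
  have : Nonempty S := hinf.nonempty.to_subtype
  obtain ⟨b, hbR⟩ := hb.hasPrimrecCopy
  obtain ⟨D, i, hdense, hD, hi, hbij, ⟨c⟩⟩ := exists_dense_set (Sᶜ : Set X)
  let p : D ≃ S := ((hbij.equiv i).trans (Equiv.Set.univ ℕ)).trans b
  have hp : ∀ x : D, p x = b (i x) := fun x => rfl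
  let q : ℕ ≃ X := (Equiv.Set.sumCompl D).symm.trans
    ((Equiv.sumCongr p c.symm).trans (Equiv.Set.sumCompl S))
  have hq : ∀ x : D, q x = p x := fun x => by
    simp [q, Equiv.Set.sumCompl_symm_apply]
  have hR : PrimrecRel fun x y => b (i x) ≤ b (i y) :=
    hbR.comp (hi.comp .fst) (hi.comp .snd)
  let sA : FirstOrder.Language.order.Structure ℕ := pullbackOrderStructure q
  have hiso : Nonempty (X ≃[FirstOrder.Language.order] ℕ) := by
    refine ⟨⟨q.symm, fun f => isEmptyElim f, ?_⟩⟩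
    rintro _ ⟨⟩ v
    change q (q.symm (v 0)) ≤ q (q.symm (v 1)) ↔ v 0 ≤ v 1
    rw [q.apply_symm_apply, q.apply_symm_apply]
  let B : FirstOrder.Language.order.Substructure ℕ := substructureOfSet D
  let pB : B ≃ S := p
  have hqB : ∀ x : B, q x = pB x := hq
  have hBA : IsSigmaElementary 1 B.subtype :=
    PreservesGaps.isSigmaElementary (f := OrderEmbedding.subtype (· ∈ S)) pB q q.injective
      (fun x y => by
        change q x ≤ q y ↔ _
        rw [hqB, hqB]
        rfl)
      (fun x y => Iff.rfl) hS _ hqB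
  refine ⟨⟨sA, hiso, B, hdense, ?_, hBA⟩, ⟨sA, hiso, B, hdense, hBA, ?_⟩⟩
  · refine isCESubstructure_of_primrec hD hR fun v hv => ?_
    change q (v 0) ≤ q (v 1) ↔ _
    rw [hq ⟨v 0, hv 0⟩, hq ⟨v 1, hv 1⟩]
    rfl
  · obtain ⟨β, _, f, q', hf, hq'inj, hq', hq'R⟩ :=
      exists_primrec_extension hb.noMinOrder_or_noMaxOrder hD p hR fun x y => by rw [hp, hp]
    let sE : FirstOrder.Language.order.Structure ℕ := pullbackOrderStructure q'
    let j : @FirstOrder.Language.Embedding FirstOrder.Language.order B ℕ _ sE :=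
      @FirstOrder.Language.Embedding.mk _ _ _ _ sE ⟨Subtype.val, Subtype.val_injective⟩
        (fun f => isEmptyElim f) (by
          rintro _ ⟨⟩ v
          change q' (v 0) ≤ q' (v 1) ↔ q (v 0) ≤ q (v 1)
          rw [hq' (v 0), hq' (v 1), hq (v 0), hq (v 1), f.le_iff_le]
          rfl)
    refine ⟨sE, ?_, j, fun x => rfl, ?_⟩
    · exact @isCESubstructure_of_primrec sE _
        (PrimrecPred.of_eq (Primrec.eq.comp (.const 0) (.const 0)) fun x => by simp) _ hq'R
        fun v _ => Iff.rfl
    · refine @PreservesGaps.isSigmaElementary B ℕ S β _ sE _ _ _ pB q' hq'inj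
        (fun x y => ?_) (fun x y => Iff.rfl) f hf j hq'
      change q x ≤ q y ↔ _
      rw [hqB, hqB]
      rfl

end Copies

theorem theorem3p5 (X : Type*) [LinearOrder X] [Infinite X] :
    letI : FirstOrder.Language.order.Structure X := FirstOrder.Language.orderStructure X
    (Countable X →
      HasSigmaGenericallyCECopy FirstOrder.Language.order 1 X ∧
      HasSigmaCoarselyCECopy FirstOrder.Language.order 1 X) ∧
    (∃ S : FirstOrder.Language.order.Substructure X,
      (S : Set X).Infinite ∧ IsSigmaElementary 1 S.subtype ∧ IsBasicOrder (S : Set X)) := by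
  let sX : FirstOrder.Language.order.Structure X := FirstOrder.Language.orderStructure X
  obtain ⟨S, hinf, hS, hb⟩ := hasBasicSuborder X
  refine ⟨fun _ => hasCECopies_of_basicSuborder hinf hS hb, substructureOfSet S, hinf, ?_, hb⟩
  have : Nonempty S := hinf.nonempty.to_subtype
  exact PreservesGaps.isSigmaElementary (M := substructureOfSet S)
    (f := OrderEmbedding.subtype (· ∈ S)) (Equiv.refl S) id Function.injective_id
    (fun x y => Iff.rfl) (fun x y => Iff.rfl) hS _ fun x => rfl
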